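/- Let $R$ be a commutative semilocal ring (with unity), i.e. $R/J(R)$ is semisimple Artinian, where $J(R)$ is the Jacobson radical of $R$. An $R$-module $M$ is called simple-direct-injective if, whenever $A$ and $B$ are isomorphic simple submodules of $M$ and $B$ is a direct summand of $M$, then $A$ is a direct summand of $M$; it is called simple-direct-projective if, whenever $A$ and $B$ are submodules of $M$ with $B$ simple, $M/A\cong B$ and $B$ a direct summand of $M$, then $A$ is a direct summand of $M$. The following statements are equivalent: 1. $R$ is perfect, i.e. $R/J(R)$ is semisimple and $J(R)$ is T-nilpotent (for every sequence $a_1,a_2,\dots$ in $J(R)$ there is an $n$ with $a_1a_2\cdots a_n=0$). 2. Every simple-direct-injective $R$-module is simple-direct-projective. 3. Every simple-direct-projective $R$-module is simple-direct-injective. -/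

import Mathlib

universe u v

namespace SimpleDirect

/-- A submodule is a direct summand if it has a complementary submodule. -/
def IsSummand {R : Type u} [Ring R] {M : Type v} [AddCommGroup M] [Module R M]
    (A : Submodule R M) : Prop :=
  ∃ C : Submodule R M, IsCompl A C

/-- `M` is simple-direct-injective: whenever `A` and `B` are isomorphic simple submodules of `M`
and `B` is a direct summand of `M`, then `A` is a direct summand of `M`. -/
def IsSimpleDirectInjective (R : Type u) [Ring R] (M : Type v) [AddCommGroup M] [Module R M] :
    Prop :=
  ∀ A B : Submodule R M, IsSimpleModule R A → IsSimpleModule R B →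
    Nonempty (A ≃ₗ[R] B) → IsSummand B → IsSummand A

/-- `M` is simple-direct-projective: whenever `A` and `B` are submodules of `M` with `B` simple,
`M ⧸ A` isomorphic to `B` and `B` a direct summand of `M`, then `A` is a direct summand of `M`. -/
def IsSimpleDirectProjective (R : Type u) [Ring R] (M : Type v) [AddCommGroup M] [Module R M] :
    Prop :=
  ∀ A B : Submodule R M, IsSimpleModule R B →
    Nonempty ((M ⧸ A) ≃ₗ[R] B) → IsSummand B → IsSummand A

/-- A ring is semilocal if its quotient by the Jacobson radical is semisimple (Artinian). -/
def IsSemilocal (R : Type u) [Ring R] : Prop :=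
  IsSemisimpleRing (R ⧸ Ring.jacobson R)

/-- An ideal of a commutative ring is T-nilpotent if for every sequence `a 0, a 1, a 2, …` of its
elements some finite initial product `a 0 * a 1 * ⋯ * a (n - 1)` vanishes. -/
def IsTNilpotent {R : Type u} [CommRing R] (I : Ideal R) : Prop :=
  ∀ a : ℕ → R, (∀ i, a i ∈ I) → ∃ n : ℕ, ∏ i ∈ Finset.range n, a i = 0

/-- A commutative ring is perfect (in the sense of Bass) if it is semisimple modulo its Jacobson
radical and the Jacobson radical is T-nilpotent. For commutative rings the left and right
versions coincide. Unrelated to `PerfectRing`, which concerns the Frobenius map. -/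
def IsPerfect (R : Type u) [CommRing R] : Prop :=
  IsSemisimpleRing (R ⧸ Ring.jacobson R) ∧ IsTNilpotent (Ring.jacobson R)

end SimpleDirect

namespace SimpleDirect

/-! ### T-nilpotent ideals, lifted idempotents and copies of `R ⧸ m` -/

section General

variable {R : Type u} [CommRing R] {M : Type v} [AddCommGroup M] [Module R M]

/-! Write J for the Jacobson radical. If `R` is perfect, J is nil, so idempotents lift: each maximal
`m` has an idempotent `e` with `1 - e ∈ m` and `e m ⊆ J`. Suppose `M` has a summand isomorphic to `R
⧸ m`. Either direct condition forces `e m M = 0`, the injective one because nonzero modules have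
nonzero elements killed by J, the projective one because `P = J P` forces `P = 0`. Then simple
submodules and simple quotients of type `R ⧸ m` all split off.

Conversely, only T-nilpotence has to be recovered. A sequence in J with nonvanishing products yields
a module `N` without simple submodules but with a simple quotient `S`, and another one with radical
`N` but with a simple submodule `S`. In both cases `S × N` separates the two conditions. -/

theorem IsTNilpotent.zero_of_step {I : Ideal R} (hI : IsTNilpotent I) {Q : R → Prop} (h1 : Q 1)
    (step : ∀ c, Q c → ∃ a ∈ I, Q (c * a)) : Q 0 := by
  choose f hfI hfQ using step
  -- `c n` is the product of the first `n` factors; each factor is chosen from the product before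
  -- it.
  let c : ℕ → {c : R // Q c} := fun n =>
    Nat.rec ⟨1, h1⟩ (fun _ c => ⟨c.1 * f c.1 c.2, hfQ c.1 c.2⟩) n
  obtain ⟨n, hn⟩ := hI (fun n => f (c n).1 (c n).2) (fun n => hfI _ _)
  have key : ∀ k, ∏ i ∈ Finset.range k, f (c i).1 (c i).2 = (c k).1 := by
    intro k
    induction k with
    | zero => rfl
    | succ k ih => rw [Finset.prod_range_succ, ih]
  rw [← hn, key]
  exact (c n).2

theorem IsTNilpotent.isNilpotent {I : Ideal R} (hI : IsTNilpotent I) {x : R} (hx : x ∈ I) :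
    IsNilpotent x := by
  obtain ⟨n, hn⟩ := hI (fun _ => x) (fun _ => hx)
  exact ⟨n, by simpa using hn⟩

theorem IsTNilpotent.exists_smul_eq_zero {I : Ideal R} (hI : IsTNilpotent I) {P : Submodule R M}
    (hP : P ≠ ⊥) : ∃ x ∈ P, x ≠ 0 ∧ ∀ a ∈ I, a • x = 0 := by
  obtain ⟨x, hx, hx0⟩ := P.ne_bot_iff.mp hP
  by_contra! h
  refine hI.zero_of_step (Q := fun c => c • x ≠ 0) (by simpa using hx0) (fun c hc => ?_)
    (zero_smul R x)
  obtain ⟨a, ha, hac⟩ := h _ (P.smul_mem c hx) hc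
  exact ⟨a, ha, by rwa [mul_comm, mul_smul]⟩

/-- Nakayama without finite generation: if `c` does not kill `P = I P`, then some `c * a` with `a ∈
I` does not either. -/
theorem IsTNilpotent.eq_bot_of_le_smul {I : Ideal R} (hI : IsTNilpotent I) {P : Submodule R M}
    (hP : P ≤ I • P) : P = ⊥ := by
  by_contra h
  obtain ⟨x, hx, hx0⟩ := P.ne_bot_iff.mp h
  refine absurd (hI.zero_of_step (Q := fun c => ∃ p ∈ P, c • p ≠ 0) ⟨x, hx, by simpa using hx0⟩ ?_)
    (by simp)
  rintro c ⟨p, hp, hcp⟩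
  by_contra! hc
  refine hcp (Submodule.smul_induction_on (p := fun y => c • y = 0) (hP hp) ?_ ?_)
  · intro a ha y hy
    rw [← mul_smul]
    exact hc a ha y hy
  · intro y z hy hz
    rw [smul_add, hy, hz, add_zero]

/-- If `J` is a nil radical with semisimple quotient, each maximal ideal is cut out modulo `J` by
an idempotent. -/
theorem exists_isIdempotentElem_of_isMaximal (hR : IsSemilocal R)
    (hJ : ∀ x ∈ Ring.jacobson R, IsNilpotent x) (m : Ideal R) [m.IsMaximal] :
    ∃ e : R, e * e = e ∧ 1 - e ∈ m ∧ ∀ y ∈ m, e * y ∈ Ring.jacobson R := by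
  have : IsSemisimpleRing (R ⧸ Ring.jacobson R) := hR
  have hJm := Ring.jacobson_le_of_isMaximal m
  let f := Ideal.Quotient.mk (Ring.jacobson R)
  have hf : Function.Surjective f := Ideal.Quotient.mk_surjective
  obtain ⟨C, hC⟩ := exists_isCompl (m.map f)
  have h1 : (1 : R ⧸ Ring.jacobson R) ∈ m.map f ⊔ C := by rw [hC.sup_eq_top]; trivial
  -- The component `q` of 1 in the complement is the idempotent to be lifted.
  obtain ⟨p, hp, q, hq, hpq⟩ := Submodule.mem_sup.mp h1
  have hmul : ∀ y ∈ m.map f, q * y = 0 := fun y hy => by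
    have : q * y ∈ m.map f ⊓ C := ⟨Ideal.mul_mem_left _ _ hy, Ideal.mul_mem_right _ _ hq⟩
    rwa [hC.inf_eq_bot] at this
  have hidem : IsIdempotentElem q := by
    change q * q = q
    have := hmul p hp
    linear_combination q * hpq - this
  obtain ⟨e, he, hfe⟩ := exists_isIdempotentElem_eq_of_ker_isNilpotent f
    (fun x hx => hJ x (by rwa [Ideal.mk_ker] at hx)) q (hf q) hidem
  refine ⟨e, he, ?_, fun y hy => ?_⟩
  · have h : f (1 - e) ∈ m.map f := by
      rw [map_sub, map_one, hfe, ← hpq, add_sub_cancel_right]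
      exact hp
    rw [Ideal.mem_map_iff_of_surjective f hf] at h
    obtain ⟨x, hx, hxe⟩ := h
    have := hJm (Ideal.Quotient.eq.mp hxe)
    have h2 := m.sub_mem hx this
    rwa [sub_sub_cancel] at h2
  · rw [← Ideal.Quotient.eq_zero_iff_mem, map_mul]
    change f e * f y = 0
    rw [hfe]
    exact hmul _ (Ideal.mem_map_of_mem f hy)

theorem nonempty_quotient_equiv_span_singleton {m : Ideal R} [hm : m.IsMaximal] {x : M}
    (hx : x ≠ 0) (h : ∀ a ∈ m, a • x = 0) : Nonempty ((R ⧸ m) ≃ₗ[R] Submodule.span R {x}) := by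
  have : m = Ideal.torsionOf R M x :=
    hm.eq_of_le (by rwa [Ne, Ideal.torsionOf_eq_top_iff]) h
  exact ⟨(Submodule.quotEquivOfEq _ _ this).trans (Ideal.quotTorsionOfEquivSpanSingleton R M x)⟩

theorem smul_eq_zero_of_equiv {m : Ideal R} (f : (R ⧸ m) ≃ₗ[R] M) {a : R} (ha : a ∈ m) (x : M) :
    a • x = 0 := by
  obtain ⟨y, rfl⟩ := f.surjective x
  obtain ⟨r, rfl⟩ := Ideal.Quotient.mk_surjective y
  rw [← map_smul]
  exact (congrArg f (Ideal.Quotient.eq_zero_iff_mem.mpr (Ideal.mul_mem_right r m ha))).trans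
    (map_zero f)

theorem isSimpleModule_quotient_of_isMaximal (m : Ideal R) [m.IsMaximal] : IsSimpleModule R (R ⧸ m) :=
  isSimpleModule_iff_quot_maximal.mpr ⟨m, inferInstance, ⟨LinearEquiv.refl R _⟩⟩

/-- A submodule containing `m • M` and missing `a` lies in a submodule missing `a` with quotient
isomorphic to `R ⧸ m`. -/
theorem exists_le_quotient_equiv (m : Ideal R) [m.IsMaximal] {P : Submodule R M}
    (hP : ∀ a ∈ m, ∀ x : M, a • x ∈ P) {a : M} (ha : a ∉ P) :
    ∃ N : Submodule R M, P ≤ N ∧ a ∉ N ∧ Nonempty ((R ⧸ m) ≃ₗ[R] M ⧸ N) := by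
  have htor : Module.IsTorsionBySet R (M ⧸ P) m := by
    rintro x ⟨r, hr⟩
    obtain ⟨y, rfl⟩ := P.mkQ_surjective x
    rw [← map_smul]
    exact (Submodule.Quotient.mk_eq_zero P).mpr (hP r hr y)
  let : Module (R ⧸ m) (M ⧸ P) := htor.module
  let : Field (R ⧸ m) := Ideal.Quotient.field m
  have : IsSemisimpleModule R (M ⧸ P) := (htor.isSemisimpleModule_iff).mp inferInstance
  have ha0 : P.mkQ a ≠ 0 := fun h => ha ((Submodule.Quotient.mk_eq_zero P).mp h)
  obtain ⟨f⟩ := nonempty_quotient_equiv_span_singleton (m := m) ha0 (fun r hr => by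
    rw [← map_smul]; exact (Submodule.Quotient.mk_eq_zero P).mpr (hP r hr a))
  obtain ⟨C, hC⟩ := exists_isCompl (Submodule.span R {P.mkQ a})
  refine ⟨C.comap P.mkQ, ?_, fun h => ha0 ?_, ⟨?_⟩⟩
  · intro x hx
    rw [Submodule.mem_comap, Submodule.mkQ_apply, (Submodule.Quotient.mk_eq_zero P).mpr hx]
    exact C.zero_mem
  · exact Submodule.disjoint_def.mp hC.disjoint _ (Submodule.mem_span_singleton_self _) h
  · have hker : LinearMap.ker (C.mkQ ∘ₗ P.mkQ) = C.comap P.mkQ := by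
      rw [LinearMap.ker_comp, Submodule.ker_mkQ]
    have hsurj : Function.Surjective (C.mkQ ∘ₗ P.mkQ) := C.mkQ_surjective.comp P.mkQ_surjective
    exact f.trans ((Submodule.quotientEquivOfIsCompl C _ hC.symm).symm.trans
      ((LinearMap.quotKerEquivOfSurjective _ hsurj).symm.trans
        (Submodule.quotEquivOfEq _ _ hker)))

theorem isCompl_of_isCoatom_of_isAtom {A B : Submodule R M} (hA : IsCoatom A) (hB : IsAtom B)
    (h : ¬ B ≤ A) : IsCompl A B :=
  ⟨(hB.not_le_iff_disjoint.mp h).symm, hA.not_le_iff_codisjoint.mp h⟩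

end General
end SimpleDirect

namespace SimpleDirect

/-! ### Modules over a perfect ring -/

section Perfect

variable {R : Type u} [CommRing R] {M : Type v} [AddCommGroup M] [Module R M]

theorem exists_isMaximal_equiv (R : Type u) [CommRing R] (M : Type v) [AddCommGroup M] [Module R M]
    [h : IsSimpleModule R M] : ∃ m : Ideal R, m.IsMaximal ∧ Nonempty ((R ⧸ m) ≃ₗ[R] M) := by
  obtain ⟨m, hm, ⟨f⟩⟩ := isSimpleModule_iff_quot_maximal.mp h
  exact ⟨m, hm, ⟨f.symm⟩⟩

theorem IsPerfect.isSimpleDirectProjective (hR : IsPerfect R)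
    (hM : IsSimpleDirectInjective R M) : IsSimpleDirectProjective R M := by
  rintro A B hB ⟨g⟩ hBs
  obtain ⟨m, hm, ⟨f⟩⟩ := exists_isMaximal_equiv R B
  have hsimple := isSimpleModule_quotient_of_isMaximal m
  obtain ⟨e, hee, he1, heJ⟩ :=
    exists_isIdempotentElem_of_isMaximal hR.1 (fun x => hR.2.isNilpotent) m
  -- Otherwise some `x = c e y z ≠ 0` is killed by J, hence by `m`, so it spans a summand with
  -- complement `C`. Since `c e y ∈ J` kills `x`, only the `C`-component of `z` contributes, and `x
  -- ∈ C`.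
  have hemM : ∀ y ∈ m, ∀ z : M, (e * y) • z = 0 := by
    intro y hy z
    by_contra h0
    obtain ⟨x, hx, hx0, hJx⟩ := hR.2.exists_smul_eq_zero (mt Submodule.span_singleton_eq_bot.mp h0)
    obtain ⟨c, rfl⟩ := Submodule.mem_span_singleton.mp hx
    set x := c • (e * y) • z with hxdef
    have hex : e • x = x := by
      rw [hxdef, smul_smul, smul_smul, smul_smul]
      congr 1
      linear_combination c * y * hee
    have hmx : ∀ a ∈ m, a • x = 0 := fun a ha => by
      rw [← hex, smul_smul, mul_comm]
      exact hJx _ (heJ a ha)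
    obtain ⟨k⟩ := nonempty_quotient_equiv_span_singleton hx0 hmx
    obtain ⟨C, hC⟩ := hM _ B (hsimple.congr k.symm) hB ⟨k.symm.trans f⟩ hBs
    have hz : z ∈ Submodule.span R {x} ⊔ C := by rw [hC.sup_eq_top]; trivial
    obtain ⟨t, ht, w, hw, htw⟩ := Submodule.mem_sup.mp hz
    obtain ⟨r, rfl⟩ := Submodule.mem_span_singleton.mp ht
    refine hx0 (Submodule.disjoint_def.mp hC.disjoint x (Submodule.mem_span_singleton_self x) ?_)
    have hj := (Ring.jacobson R).mul_mem_left c (heJ y hy)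
    have : x = (c * (e * y)) • w := by
      have h1 : (c * (e * y)) • r • x = 0 := by rw [smul_comm, hJx _ hj, smul_zero]
      rw [hxdef, smul_smul]
      nth_rewrite 1 [← htw]
      rw [smul_add, h1, zero_add]
    rw [this]
    exact C.smul_mem _ hw
  have hA : IsCoatom A := isSimpleModule_iff_isCoatom.mp (hB.congr g)
  obtain ⟨x, -, hx⟩ := SetLike.exists_of_lt hA.lt_top
  have hmA : ∀ a ∈ m, a • x ∈ A := fun a ha => by
    rw [← Submodule.Quotient.mk_eq_zero, Submodule.Quotient.mk_smul]
    exact smul_eq_zero_of_equiv (f.trans g.symm) ha _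
  have hex : e • x ∉ A := fun h => hx <| by
    have := A.add_mem h (hmA _ he1)
    rwa [← add_smul, add_sub_cancel, one_smul] at this
  obtain ⟨k⟩ := nonempty_quotient_equiv_span_singleton (m := m) (x := e • x)
    (fun h => hex (h ▸ A.zero_mem)) (fun a ha => by rw [smul_smul, mul_comm, hemM a ha])
  exact ⟨_, isCompl_of_isCoatom_of_isAtom hA
    (isSimpleModule_iff_isAtom.mp (hsimple.congr k.symm))
    (fun h => hex (h (Submodule.mem_span_singleton_self _)))⟩

theorem IsPerfect.isSimpleDirectInjective (hR : IsPerfect R)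
    (hM : IsSimpleDirectProjective R M) : IsSimpleDirectInjective R M := by
  rintro A B hA hB ⟨g⟩ hBs
  obtain ⟨m, hm, ⟨f⟩⟩ := exists_isMaximal_equiv R B
  have hsimple := isSimpleModule_quotient_of_isMaximal m
  obtain ⟨e, hee, he1, heJ⟩ :=
    exists_isIdempotentElem_of_isMaximal hR.1 (fun x => hR.2.isNilpotent) m
  let Z := Submodule.torsionBySet R M (m : Set R)
  -- Otherwise a maximal `N` above the sum has a complement isomorphic to `R ⧸ m`, which lies in `Z
  -- ≤ N`.
  have htop : Z ⊔ m • (⊤ : Submodule R M) = ⊤ := by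
    by_contra hne
    obtain ⟨a, -, ha⟩ := SetLike.exists_of_lt (lt_top_iff_ne_top.mpr hne)
    obtain ⟨N, hN, haN, ⟨k⟩⟩ := exists_le_quotient_equiv m
      (fun r hr x => Submodule.mem_sup_right (Submodule.smul_mem_smul hr Submodule.mem_top)) ha
    obtain ⟨C, hC⟩ := hM N B hB ⟨k.symm.trans f⟩ hBs
    have hCN : C ≤ N := fun x hx => hN <| Submodule.mem_sup_left <|
      (Submodule.mem_torsionBySet_iff _ _).mpr fun r => by
        simpa using congrArg Subtype.val (smul_eq_zero_of_equiv
          (k.trans (Submodule.quotientEquivOfIsCompl N C hC)) r.2 ⟨x, hx⟩)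
    apply haN
    have : N = ⊤ := by rw [← hC.sup_eq_top, sup_eq_left.mpr hCN]
    rw [this]; trivial
  -- As `m` kills `Z`, `e m M = e m (m M) = (e m)(e m M) ⊆ J (e m M)`.
  have hP : (Ideal.span {e} * m) • (⊤ : Submodule R M) = ⊥ := by
    refine hR.2.eq_bot_of_le_smul (Submodule.smul_le.mpr ?_)
    intro i hi z _
    obtain ⟨y, hy, rfl⟩ := Ideal.mem_span_singleton_mul.mp hi
    have hz : z ∈ Z ⊔ m • (⊤ : Submodule R M) := by rw [htop]; trivial
    obtain ⟨s, hs, w, hw, rfl⟩ := Submodule.mem_sup.mp hz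
    have hs0 : (e * y) • s = 0 := by
      rw [mul_smul, (Submodule.mem_torsionBySet_iff _ _).mp hs ⟨y, hy⟩, smul_zero]
    rw [smul_add, hs0, zero_add]
    refine Submodule.smul_induction_on hw (fun y' hy' z' _ => ?_) (fun w₁ w₂ h₁ h₂ => ?_)
    · have : (e * y) • y' • z' = (e * y) • (e * y') • z' := by
        rw [smul_smul, smul_smul]
        congr 1
        linear_combination -(y * y') * hee
      rw [this]
      exact Submodule.smul_mem_smul (heJ y hy) (Submodule.smul_mem_smul
        (Ideal.mem_span_singleton_mul.mpr ⟨y', hy', rfl⟩) trivial)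
    · rw [smul_add]
      exact add_mem h₁ h₂
  obtain ⟨a, ha, ha0⟩ := A.ne_bot_iff.mp (isSimpleModule_iff_isAtom.mp hA).1
  have hma : ∀ r ∈ m, r • a = 0 := fun r hr => by
    simpa using congrArg Subtype.val (smul_eq_zero_of_equiv (f.trans g.symm) hr ⟨a, ha⟩)
  have hea : e • a = a := by
    have := hma _ he1
    rw [sub_smul, one_smul, sub_eq_zero] at this
    exact this.symm
  have ham : a ∉ m • (⊤ : Submodule R M) := fun h => ha0 <| by
    have : e • a ∈ (Ideal.span {e} * m) • (⊤ : Submodule R M) := by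
      rw [← smul_eq_mul, Submodule.smul_assoc]
      exact Submodule.smul_mem_smul (Ideal.mem_span_singleton_self e) h
    rwa [hea, hP] at this
  obtain ⟨N, hN, haN, ⟨k⟩⟩ := exists_le_quotient_equiv m
    (fun r hr x => Submodule.smul_mem_smul hr Submodule.mem_top) ham
  exact ⟨N, (isCompl_of_isCoatom_of_isAtom
    (isSimpleModule_iff_isCoatom.mp (hsimple.congr k.symm)) (isSimpleModule_iff_isAtom.mp hA)
    (fun h => haN (h ha))).symm⟩

end Perfect

/-! ### Products of a simple module with a module lacking simple submodules or maximal submodules -/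

section Product

variable {R : Type u} [CommRing R] {S N : Type v} [AddCommGroup S] [AddCommGroup N] [Module R S]
  [Module R N]

open LinearMap (inl inr fst snd range ker)

theorem isAtom_range_of_injective [hS : IsSimpleModule R S] {f : S →ₗ[R] N}
    (hf : Function.Injective f) : IsAtom (range f) :=
  isSimpleModule_iff_isAtom.mp (hS.congr (LinearEquiv.ofInjective f hf).symm)

theorem eq_range_inl_of_isSimpleModule [hS : IsSimpleModule R S]
    (hN : ∀ T : Submodule R N, ¬ IsSimpleModule R T) (A : Submodule R (S × N))
    [hA : IsSimpleModule R A] : A = range (inl R S N) := by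
  have hle : A ≤ range (inl R S N) := by
    rcases LinearMap.injective_or_eq_zero (snd R S N ∘ₗ A.subtype) with h | h
    · exact absurd (hA.congr (LinearEquiv.ofInjective _ h).symm) (hN _)
    · rw [LinearMap.range_inl]
      exact fun x hx => LinearMap.congr_fun h ⟨x, hx⟩
  have hinl := isAtom_range_of_injective (f := inl R S N) LinearMap.inl_injective
  exact (hinl.le_iff.mp hle).resolve_left (isSimpleModule_iff_isAtom.mp hA).1

theorem isSimpleDirectInjective_prod [IsSimpleModule R S]
    (hN : ∀ T : Submodule R N, ¬ IsSimpleModule R T) : IsSimpleDirectInjective R (S × N) := by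
  intro A B hA hB _ hBs
  rwa [eq_range_inl_of_isSimpleModule hN A, ← eq_range_inl_of_isSimpleModule hN B]

/-- A complement of the kernel of `S × N → N → S` would be simple, hence `S × 0`, which lies in that
kernel. -/
theorem not_isSimpleDirectProjective_prod [hS : IsSimpleModule R S]
    (hN : ∀ T : Submodule R N, ¬ IsSimpleModule R T) {f : N →ₗ[R] S}
    (hf : Function.Surjective f) : ¬ IsSimpleDirectProjective R (S × N) := by
  intro h
  have hsurj : Function.Surjective (f ∘ₗ snd R S N) := hf.comp Prod.snd_surjective
  have hq := LinearMap.quotKerEquivOfSurjective _ hsurj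
  have hinl := LinearEquiv.ofInjective (inl R S N) LinearMap.inl_injective
  obtain ⟨C, hC⟩ := h _ (range (inl R S N)) (hS.congr hinl.symm) ⟨hq.trans hinl⟩
    ⟨_, LinearMap.isCompl_range_inl_inr⟩
  have hCs : IsSimpleModule R C :=
    hS.congr ((Submodule.quotientEquivOfIsCompl _ C hC).symm.trans hq)
  refine (isSimpleModule_iff_isAtom.mp hCs).1 (hC.symm.disjoint.eq_bot_of_le ?_)
  rw [eq_range_inl_of_isSimpleModule hN C, LinearMap.range_inl, LinearMap.ker_comp]
  exact Submodule.comap_mono bot_le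

theorem eq_range_inr_of_isCoatom [hS : IsSimpleModule R S] (hN : Module.jacobson R N = ⊤)
    {A : Submodule R (S × N)} (hA : IsCoatom A) : A = range (inr R S N) := by
  have hle : range (inr R S N) ≤ A := by
    rw [LinearMap.range_eq_map, ← hN, Submodule.map_le_iff_le_comap]
    exact (Module.le_comap_jacobson _).trans (Submodule.comap_mono (sInf_le hA))
  have hinr : IsCoatom (range (inr R S N)) := by
    rw [LinearMap.range_inr]
    exact LinearMap.isCoatom_ker_of_surjective Prod.fst_surjective
  exact (hinr.le_iff.mp hle).resolve_left hA.1

theorem isSimpleDirectProjective_prod [IsSimpleModule R S] (hN : Module.jacobson R N = ⊤) :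
    IsSimpleDirectProjective R (S × N) := by
  rintro A B hB ⟨g⟩ -
  rw [eq_range_inr_of_isCoatom hN (isSimpleModule_iff_isCoatom.mp (hB.congr g))]
  exact ⟨_, LinearMap.isCompl_range_inl_inr.symm⟩

/-- A complement of `0 × f(S)` would be maximal, hence `0 × N`, which contains it. -/
theorem not_isSimpleDirectInjective_prod [hS : IsSimpleModule R S]
    (hN : Module.jacobson R N = ⊤) {f : S →ₗ[R] N} (hf : Function.Injective f) :
    ¬ IsSimpleDirectInjective R (S × N) := by
  intro h
  have hinj : Function.Injective (inr R S N ∘ₗ f) := LinearMap.inr_injective.comp hf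
  have hA := LinearEquiv.ofInjective _ hinj
  have hinl := LinearEquiv.ofInjective (inl R S N) LinearMap.inl_injective
  obtain ⟨C, hC⟩ := h _ (range (inl R S N)) (hS.congr hA.symm) (hS.congr hinl.symm)
    ⟨hA.symm.trans hinl⟩ ⟨_, LinearMap.isCompl_range_inl_inr⟩
  have hCs : IsSimpleModule R ((S × N) ⧸ C) :=
    hS.congr ((Submodule.quotientEquivOfIsCompl C _ hC.symm).trans hA.symm)
  refine (isAtom_range_of_injective hinj).1 (hC.disjoint.eq_bot_of_le ?_)
  rw [eq_range_inr_of_isCoatom hN (isSimpleModule_iff_isCoatom.mp hCs)]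
  exact LinearMap.range_comp_le_range _ _

end Product
end SimpleDirect

namespace SimpleDirect

/-! ### Counterexamples when the radical is not T-nilpotent -/

section NotTNilpotent

variable {R : Type u} [CommRing R]

theorem jacobson_smul_eq_zero {M : Type v} [AddCommGroup M] [Module R M] [IsSimpleModule R M]
    {a : R} (ha : a ∈ Ring.jacobson R) (x : M) : a • x = 0 := by
  have : (Module.annihilator R M).IsMaximal := IsSimpleModule.annihilator_isMaximal
  exact Module.mem_annihilator.mp (Ring.jacobson_le_of_isMaximal _ ha) x

theorem exists_ideal_quotient_no_simple {a : ℕ → R} (ha : ∀ i, a i ∈ Ring.jacobson R)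
    (hprod : ∀ n, ∏ i ∈ Finset.range n, a i ≠ 0) :
    ∃ I : Ideal R, I ≠ ⊤ ∧ ∀ T : Submodule R (R ⧸ I), ¬ IsSimpleModule R T := by
  -- For `I` maximal avoiding all partial products, the preimage of a simple `T` contains one of
  -- them; the next factor lies in J and kills `T`, so the next product is in `I`.
  obtain ⟨I, hI⟩ := zorn_le₀ {I : Ideal R | ∀ n, ∏ i ∈ Finset.range n, a i ∉ I} (by
    intro c hc hchain
    rcases c.eq_empty_or_nonempty with rfl | hne
    · exact ⟨⊥, fun n => by simpa using hprod n, by simp⟩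
    · refine ⟨sSup c, fun n hn => ?_, fun z hz => le_sSup hz⟩
      obtain ⟨K, hK, hnK⟩ := (Submodule.mem_sSup_of_directed hne hchain.directedOn).mp hn
      exact hc hK n hnK)
  refine ⟨I, fun h => hI.1 0 (h ▸ trivial), fun T hT => ?_⟩
  have hle : I ≤ T.comap I.mkQ := fun x hx => by
    rw [Submodule.mem_comap, Submodule.mkQ_apply, (Submodule.Quotient.mk_eq_zero I).mpr hx]
    exact T.zero_mem
  have hlt : ¬ T.comap I.mkQ ≤ I := fun h => by
    refine (isSimpleModule_iff_isAtom.mp hT).1 ((Submodule.eq_bot_iff T).mpr fun x hx => ?_)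
    obtain ⟨y, rfl⟩ := I.mkQ_surjective x
    exact (Submodule.Quotient.mk_eq_zero I).mpr (h hx)
  have hK : ∃ n, ∏ i ∈ Finset.range n, a i ∈ T.comap I.mkQ := by
    by_contra! h
    exact hlt (hI.2 h hle)
  obtain ⟨n, hn⟩ := hK
  refine hI.1 (n + 1) ?_
  have := congrArg Subtype.val (jacobson_smul_eq_zero (ha n) (⟨_, hn⟩ : T))
  rw [Finset.prod_range_succ, mul_comm, ← smul_eq_mul]
  exact (Submodule.Quotient.mk_eq_zero I).mp this

/-- The relations `e n - a n • e (n + 1)` of the direct limit of `R → R → ⋯` along the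
multiplications by `a n`. -/
noncomputable def bassRelations (a : ℕ → R) : (ℕ →₀ R) →ₗ[R] (ℕ →₀ R) :=
  Finsupp.linearCombination R fun n => Finsupp.single n 1 - a n • Finsupp.single (n + 1) 1

theorem bassRelations_apply_zero (a : ℕ → R) (f : ℕ →₀ R) : bassRelations a f 0 = f 0 := by
  induction f using Finsupp.induction_linear with
  | zero => simp
  | add f g hf hg => simp [hf, hg]
  | single n r => simp [bassRelations, Finsupp.single_apply]

theorem bassRelations_apply_succ (a : ℕ → R) (f : ℕ →₀ R) (n : ℕ) :
    bassRelations a f (n + 1) = f (n + 1) - a n * f n := by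
  induction f using Finsupp.induction_linear with
  | zero => simp
  | add f g hf hg => simp [hf, hg]; ring
  | single k r =>
    by_cases hk : k = n
    · subst hk
      simp [bassRelations, mul_comm]
    · simp [bassRelations, Finsupp.single_apply, hk]

/-- The coefficients of a preimage would be the partial products, none of which vanishes, against
finite support. -/
theorem single_zero_notMem_range_bassRelations {a : ℕ → R}
    (hprod : ∀ n, ∏ i ∈ Finset.range n, a i ≠ 0) :
    Finsupp.single 0 1 ∉ LinearMap.range (bassRelations a) := by
  rintro ⟨f, hf⟩
  have key : ∀ n, f n = ∏ i ∈ Finset.range n, a i := by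
    intro n
    induction n with
    | zero => simpa [bassRelations_apply_zero] using DFunLike.congr_fun hf 0
    | succ n ih =>
      have := DFunLike.congr_fun hf (n + 1)
      rw [bassRelations_apply_succ, Finsupp.single_eq_of_ne (by simp), sub_eq_zero] at this
      rw [this, Finset.prod_range_succ, ih, mul_comm]
  obtain ⟨n, hn⟩ := Infinite.exists_notMem_finset f.support
  exact hprod n (by rw [← key, Finsupp.notMem_support_iff.mp hn])

theorem jacobson_quotient_eq_top {a : ℕ → R} (ha : ∀ i, a i ∈ Ring.jacobson R)
    {W : Submodule R (ℕ →₀ R)} (hW : LinearMap.range (bassRelations a) ≤ W) :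
    Module.jacobson R ((ℕ →₀ R) ⧸ W) = ⊤ := by
  rw [eq_top_iff]
  refine le_trans ?_ (Ring.jacobson_smul_top_le R _)
  rintro x -
  obtain ⟨f, rfl⟩ := W.mkQ_surjective x
  induction f using Finsupp.induction_linear with
  | zero => simp
  | add f g hf hg => rw [map_add]; exact add_mem hf hg
  | single n r =>
    have h : W.mkQ (Finsupp.single n 1) = a n • W.mkQ (Finsupp.single (n + 1) 1) := by
      rw [← map_smul, ← sub_eq_zero, ← map_sub]
      exact (Submodule.Quotient.mk_eq_zero W).mpr
        (hW ⟨Finsupp.single n 1, by simp [bassRelations]⟩)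
    rw [← mul_one r, ← smul_eq_mul, ← Finsupp.smul_single, map_smul, h]
    exact Submodule.smul_mem _ _ (Submodule.smul_mem_smul (ha n) trivial)

theorem exists_module_jacobson_eq_top {a : ℕ → R} (ha : ∀ i, a i ∈ Ring.jacobson R)
    (hprod : ∀ n, ∏ i ∈ Finset.range n, a i ≠ 0) :
    ∃ (m : Ideal R) (W : Submodule R (ℕ →₀ R)) (f : (R ⧸ m) →ₗ[R] ((ℕ →₀ R) ⧸ W)), m.IsMaximal ∧
      Module.jacobson R ((ℕ →₀ R) ⧸ W) = ⊤ ∧ Function.Injective f := by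
  set G := LinearMap.range (bassRelations a)
  set e : ℕ →₀ R := Finsupp.single 0 1
  have he : e ∉ G := single_zero_notMem_range_bassRelations hprod
  obtain ⟨m, hm, hle⟩ := Ideal.exists_le_maximal (G.comap (LinearMap.toSpanSingleton R _ e))
    (fun h => he (by simpa using (Ideal.eq_top_iff_one _).mp h))
  -- `m` contains the annihilator of `e` modulo `G`, so also killing `m e` leaves `e` nonzero,
  -- spanning a copy of `R ⧸ m`.
  let W := G ⊔ Submodule.map (LinearMap.toSpanSingleton R _ e) m
  have heW : W.mkQ e ≠ 0 := fun h => by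
    obtain ⟨g, hg, y, ⟨r, hr, rfl⟩, hgy⟩ :=
      Submodule.mem_sup.mp ((Submodule.Quotient.mk_eq_zero W).mp h)
    have h1 : (1 - r) ∈ m := hle <| by
      rw [Submodule.mem_comap, map_sub, LinearMap.toSpanSingleton_apply_one,
        ← eq_sub_of_add_eq hgy]
      exact hg
    exact hm.ne_top (m.eq_top_iff_one.mpr (by simpa using m.add_mem h1 hr))
  obtain ⟨k⟩ := nonempty_quotient_equiv_span_singleton (m := m) heW (fun r hr => by
    rw [← map_smul]
    exact (Submodule.Quotient.mk_eq_zero W).mpr (Submodule.mem_sup_right ⟨r, hr, rfl⟩))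
  exact ⟨m, W, (Submodule.subtype _) ∘ₗ k.toLinearMap, hm, jacobson_quotient_eq_top ha le_sup_left,
    Subtype.val_injective.comp k.injective⟩

theorem isTNilpotent_of_injective_imp_projective
    (h : ∀ (M : Type (max u v)) [AddCommGroup M] [Module R M],
      IsSimpleDirectInjective R M → IsSimpleDirectProjective R M) :
    IsTNilpotent (Ring.jacobson R) := by
  intro a ha
  by_contra! hprod
  obtain ⟨I, hI, hT⟩ := exists_ideal_quotient_no_simple ha hprod
  obtain ⟨m, hm, hIm⟩ := Ideal.exists_le_maximal I hI
  have : IsSimpleModule R (ULift.{v} (R ⧸ m)) :=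
    (isSimpleModule_quotient_of_isMaximal m).congr ULift.moduleEquiv
  have hT' : ∀ T : Submodule R (ULift.{v} (R ⧸ I)), ¬ IsSimpleModule R T := fun T hs =>
    hT _ (hs.congr (ULift.moduleEquiv.submoduleMap T).symm)
  refine not_isSimpleDirectProjective_prod (S := ULift.{v} (R ⧸ m)) hT'
    (f := ULift.moduleEquiv.symm.toLinearMap ∘ₗ Submodule.factor hIm ∘ₗ
      ULift.moduleEquiv.toLinearMap) ?_ (h _ (isSimpleDirectInjective_prod hT'))
  exact ULift.moduleEquiv.symm.surjective.comp
    ((Submodule.factor_surjective hIm).comp ULift.moduleEquiv.surjective)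

theorem isTNilpotent_of_projective_imp_injective
    (h : ∀ (M : Type (max u v)) [AddCommGroup M] [Module R M],
      IsSimpleDirectProjective R M → IsSimpleDirectInjective R M) :
    IsTNilpotent (Ring.jacobson R) := by
  intro a ha
  by_contra! hprod
  obtain ⟨m, W, f, hm, hW, hf⟩ := exists_module_jacobson_eq_top ha hprod
  have : IsSimpleModule R (ULift.{v} (R ⧸ m)) :=
    (isSimpleModule_quotient_of_isMaximal m).congr ULift.moduleEquiv
  have hN : Module.jacobson R (ULift.{v} ((ℕ →₀ R) ⧸ W)) = ⊤ := by
    have := Module.comap_jacobson_of_bijective (f := (ULift.moduleEquiv (R := R) :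
      ULift.{v} ((ℕ →₀ R) ⧸ W) ≃ₗ[R] _).toLinearMap) ULift.moduleEquiv.bijective
    rw [← this, hW, Submodule.comap_top]
  refine not_isSimpleDirectInjective_prod (S := ULift.{v} (R ⧸ m)) hN
    (f := ULift.moduleEquiv.symm.toLinearMap ∘ₗ f ∘ₗ ULift.moduleEquiv.toLinearMap) ?_
    (h _ (isSimpleDirectProjective_prod hN))
  exact ULift.moduleEquiv.symm.injective.comp (hf.comp ULift.moduleEquiv.injective)

end NotTNilpotent
end SimpleDirect

theorem corollary4p12 (R : Type u) [CommRing R] (hR : SimpleDirect.IsSemilocal R) :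
    List.TFAE [
      SimpleDirect.IsPerfect R,
      ∀ (M : Type (max u v)) [AddCommGroup M] [Module R M],
        SimpleDirect.IsSimpleDirectInjective R M → SimpleDirect.IsSimpleDirectProjective R M,
      ∀ (M : Type (max u v)) [AddCommGroup M] [Module R M],
        SimpleDirect.IsSimpleDirectProjective R M → SimpleDirect.IsSimpleDirectInjective R M] := by
  tfae_have 1 → 2 := fun h M _ _ => h.isSimpleDirectProjective
  tfae_have 1 → 3 := fun h M _ _ => h.isSimpleDirectInjective
  tfae_have 2 → 1 := fun h =>
    ⟨hR, SimpleDirect.isTNilpotent_of_injective_imp_projective.{u, v} h⟩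
  tfae_have 3 → 1 := fun h =>
    ⟨hR, SimpleDirect.isTNilpotent_of_projective_imp_injective.{u, v} h⟩
  tfae_finish
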